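/- For every finite group $\mathfrak{G}$ there exist infinitely many pairwise non-isomorphic finite connected nut graphs $G$ such that $\operatorname{Aut}(G) \cong \mathfrak{G}$. Here a nut graph is a finite simple graph with at least two vertices whose adjacency matrix (over $\mathbb{R}$) has nullity $1$ and all of whose non-zero kernel vectors have no zero entry, and $\operatorname{Aut}(G)$ denotes the full automorphism group of $G$, that is, the group of all permutations of the vertices of $G$ that map edges to edges and non-edges to non-edges. -/

import Mathlib

open Classical in
/-- The kernel (null space) of the real adjacency matrix of a finite simple graph. -/
noncomputable def adjKer {V : Type*} [Fintype V] (Γ : SimpleGraph V) : Submodule ℝ (V → ℝ) :=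
  LinearMap.ker (Γ.adjMatrix ℝ).mulVecLin

/-- A nut graph: a finite simple graph with at least two vertices whose adjacency matrix has
nullity one and all of whose nonzero kernel vectors have no zero entry. -/
structure IsNutGraph {V : Type*} [Fintype V] (Γ : SimpleGraph V) : Prop where
  two_le_card : 2 ≤ Fintype.card V
  nullity_eq_one : Module.finrank ℝ (adjKer Γ) = 1
  kernel_full : ∀ x ∈ adjKer Γ, x ≠ 0 → ∀ v, x v ≠ 0

/-! Each arc of a Cayley digraph of the group is replaced by a path through two mid vertices, and
one global path with `8 * m - 3` vertices marks the kinds of arc and their direction. Here `S` is a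
multiset of group elements: every element occurs, the identity several times.

Automorphisms: conditions on triangles separate core, mid and path vertices. The path cannot be
reversed, because only its first half lies in triangles, so it is fixed pointwise. Its attachments
then fix the kind of each mid vertex, and the induced map on the core commutes with right
multiplication by every element; hence it is a left translation (`aut_eq_translate`).

Kernel: equations at odd path positions make the even entries alternate, so they are determined by
the entry at position 0. If that entry is zero, eliminating the mid vertices leaves `(J + l I) c =
0` on the core, `J` being the all-ones matrix; this is positive definite, so everything vanishes
(`eq_zero_of_mem_adjKer`). The nullity is therefore at most one, and `nutVector` is an explicit
nowhere zero kernel vector. Varying the number of extra identities changes the order of the graph,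
which gives infinitely many. -/

open Classical in
theorem mem_adjKer_iff {V : Type*} [Fintype V] (Γ : SimpleGraph V) (x : V → ℝ) :
    x ∈ adjKer Γ ↔ ∀ u, ∑ w, (if Γ.Adj u w then x w else 0) = 0 := by
  unfold adjKer
  rw [LinearMap.mem_ker, funext_iff]
  simp [Matrix.mulVec, dotProduct, SimpleGraph.adjMatrix_apply]

/-- A nowhere zero kernel vector together with a coordinate that detects the kernel. -/
theorem isNutGraph_of_kernel_vector {V : Type*} [Fintype V] (Γ : SimpleGraph V)
    (hcard : 2 ≤ Fintype.card V) (v : V → ℝ) (hv0 : ∀ u, v u ≠ 0) (hv : v ∈ adjKer Γ) (p : V)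
    (hp : ∀ x ∈ adjKer Γ, x p = 0 → x = 0) : IsNutGraph Γ := by
  have key : ∀ x ∈ adjKer Γ, x = (x p / v p) • v := by
    intro x hx
    have h := hp (x - (x p / v p) • v)
      (Submodule.sub_mem _ hx (Submodule.smul_mem _ _ hv)) (by simp [hv0 p])
    exact sub_eq_zero.mp h
  refine ⟨hcard, ?_, ?_⟩
  · rw [finrank_eq_one_iff']
    refine ⟨⟨v, hv⟩, ?_, ?_⟩
    · intro h
      exact hv0 p (congrFun (congrArg Subtype.val h) p)
    · rintro ⟨x, hx⟩
      exact ⟨x p / v p, Subtype.ext (key x hx).symm⟩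
  · intro x hx hx0 u hu
    have h := key x hx
    have h1 : x p / v p ≠ 0 := by
      intro h0
      rw [h0, zero_smul] at h
      exact hx0 h
    rw [h, Pi.smul_apply, smul_eq_mul] at hu
    exact (mul_ne_zero h1 (hv0 u)) hu

theorem comp_mem_adjKer {V W : Type*} [Fintype V] [Fintype W] {Γ : SimpleGraph V}
    {Δ : SimpleGraph W} (e : Γ ≃g Δ) {x : W → ℝ} (hx : x ∈ adjKer Δ) : x ∘ e ∈ adjKer Γ := by
  classical
  rw [mem_adjKer_iff] at hx ⊢
  intro u
  refine Eq.trans ?_ (hx (e u))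
  rw [← e.toEquiv.sum_comp]
  refine Finset.sum_congr rfl fun w _ => ?_
  have : Δ.Adj (e u) (e.toEquiv w) ↔ Γ.Adj u w := e.map_adj_iff
  simp only [this]
  rfl

theorem IsNutGraph.of_iso {V W : Type*} [Fintype V] [Fintype W] {Γ : SimpleGraph V}
    {Δ : SimpleGraph W} (e : Γ ≃g Δ) (h : IsNutGraph Γ) : IsNutGraph Δ := by
  have mem : ∀ x : W → ℝ, x ∈ adjKer Δ ↔ x ∘ e ∈ adjKer Γ := by
    refine fun x => ⟨comp_mem_adjKer e, fun hx => ?_⟩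
    have := comp_mem_adjKer e.symm hx
    rwa [Function.comp_assoc, show (e ∘ e.symm : W → W) = id from funext e.apply_symm_apply,
      Function.comp_id] at this
  refine ⟨(Fintype.card_congr e.toEquiv) ▸ h.two_le_card, ?_, ?_⟩
  · rw [← h.nullity_eq_one]
    refine LinearEquiv.finrank_eq ((LinearEquiv.funCongrLeft ℝ ℝ e.toEquiv).ofSubmodules _ _ ?_)
    ext y
    constructor
    · rintro ⟨x, hx, rfl⟩
      exact (mem x).1 hx
    · intro hy
      refine ⟨y ∘ e.symm, (mem _).2 ?_, ?_⟩
      · convert hy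
        ext a; simp
      · ext a
        exact congrArg y (e.symm_apply_apply a)
  · intro x hx hx0 w
    have := h.kernel_full (x ∘ e) ((mem x).1 hx) (fun h0 => hx0 ?_) (e.symm w)
    · simpa using this
    · ext a
      simpa using congrFun h0 (e.symm a)

/-- Conjugation by an isomorphism identifies the automorphism groups. -/
def autCongr {V W : Type*} {Γ : SimpleGraph V} {Δ : SimpleGraph W} (e : Γ ≃g Δ) :
    (Δ ≃g Δ) ≃* (Γ ≃g Γ) where
  toFun φ := (e.trans φ).trans e.symm
  invFun φ := (e.symm.trans φ).trans e
  left_inv φ := by ext; simp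
  right_inv φ := by ext; simp
  map_mul' φ ψ := by
    ext v
    simp [RelIso.mul_apply]

/-! ### The construction, its translations and connectedness -/

inductive NutVertex (G S : Type*) (K : ℕ)
  | core (g : G)
  | mid (g : G) (s : S) (b : Bool)
  | path (i : Fin K)

namespace NutVertex

variable {G S : Type*} {K : ℕ}

def equivSum (G S : Type*) (K : ℕ) : NutVertex G S K ≃ (G ⊕ (G × S × Bool)) ⊕ Fin K where
  toFun
    | core g => .inl (.inl g)
    | mid g s b => .inl (.inr (g, s, b))
    | path i => .inr i
  invFun
    | .inl (.inl g) => core g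
    | .inl (.inr (g, s, b)) => mid g s b
    | .inr i => path i
  left_inv v := by cases v <;> rfl
  right_inv v := by rcases v with (g | ⟨g, s, b⟩) | i <;> rfl

instance [Fintype G] [Fintype S] : Fintype (NutVertex G S K) :=
  Fintype.ofEquiv _ (equivSum G S K).symm

theorem card_eq [Fintype G] [Fintype S] : Fintype.card (NutVertex G S K) =
    Fintype.card G + Fintype.card G * (Fintype.card S * 2) + K := by
  simp [Fintype.card_congr (equivSum G S K)]

theorem sum_eq [Fintype G] [Fintype S] (f : NutVertex G S K → ℝ) :
    ∑ v, f v = ∑ g, f (core g) + ∑ g, ∑ s, (f (mid g s false) + f (mid g s true))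
      + ∑ i, f (path i) := by
  rw [← (equivSum G S K).symm.sum_comp]
  simp only [Fintype.sum_sum_type, Fintype.sum_prod_type, Fintype.sum_bool]
  simp only [equivSum, Equiv.symm, Equiv.coe_fn_mk]
  simp [add_comm]

end NutVertex

open NutVertex

section

variable {G S : Type*} [Group G] {m : ℕ}

/-- Two core vertices `g` and `g * σ s` are joined by a path through `mid g s false` and
`mid g s true`; the vertices of each kind are attached to fixed positions of one global path. -/
def NutAdj (σ : S → G) (idx : S × Bool ≃ Fin m) :
    NutVertex G S (8 * m - 3) → NutVertex G S (8 * m - 3) → Prop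
  | core _, core _ => False
  | core g, mid h s b => g = if b then h * σ s else h
  | core _, path i => 4 ∣ i.val
  | mid h s b, core g => g = if b then h * σ s else h
  | mid g s b, mid h t c => g = h ∧ s = t ∧ b = !c
  | mid _ s b, path i => i.val = 4 * (idx (s, b)).val
  | path i, core _ => 4 ∣ i.val
  | path i, mid _ s b => i.val = 4 * (idx (s, b)).val
  | path i, path j => i.val + 1 = j.val ∨ j.val + 1 = i.val

def nutGraph (σ : S → G) (idx : S × Bool ≃ Fin m) : SimpleGraph (NutVertex G S (8 * m - 3)) where
  Adj := NutAdj σ idx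
  symm := ⟨by
    rintro (g | ⟨g, s, b⟩ | i) (h | ⟨h, t, c⟩ | j) <;> simp only [NutAdj, imp_self]
    · rintro ⟨rfl, rfl, rfl⟩; simp
    · exact Or.symm⟩
  loopless := ⟨by rintro (g | ⟨g, s, b⟩ | i) <;> simp [NutAdj]⟩

variable (σ : S → G) (idx : S × Bool ≃ Fin m)

theorem nutGraph_adj (u v : NutVertex G S (8 * m - 3)) :
    (nutGraph σ idx).Adj u v ↔ NutAdj σ idx u v := Iff.rfl

/-- Left multiplication as an automorphism. -/
def nutTranslate (a : G) : nutGraph σ idx ≃g nutGraph σ idx where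
  toFun
    | core g => core (a * g)
    | mid g s b => mid (a * g) s b
    | path i => path i
  invFun
    | core g => core (a⁻¹ * g)
    | mid g s b => mid (a⁻¹ * g) s b
    | path i => path i
  left_inv v := by cases v <;> simp
  right_inv v := by cases v <;> simp
  map_rel_iff' := by
    rintro (g | ⟨g, s, b⟩ | i) (h | ⟨h, t, c⟩ | j) <;>
      simp only [nutGraph_adj, NutAdj, Equiv.coe_fn_mk, mul_right_inj]
    · cases c <;> simp [mul_assoc]
    · cases b <;> simp [mul_assoc]

def nutTranslateHom : G →* (nutGraph σ idx ≃g nutGraph σ idx) where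
  toFun := nutTranslate σ idx
  map_one' := by
    ext v; rcases v with g | ⟨g, s, b⟩ | i <;> simp [nutTranslate, RelIso.one_apply]
  map_mul' a b := by
    ext v; rcases v with g | ⟨g, s, b⟩ | i <;> simp [nutTranslate, RelIso.mul_apply, mul_assoc]

theorem nutGraph_connected (hm : 0 < m) : (nutGraph σ idx).Connected := by
  have h0 : 0 < 8 * m - 3 := by omega
  have path_reach : ∀ (i : ℕ) (hi : i < 8 * m - 3),
      (nutGraph σ idx).Reachable (path ⟨0, h0⟩) (path ⟨i, hi⟩) := by
    intro i
    induction i with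
    | zero => exact fun _ => SimpleGraph.Reachable.refl _
    | succ i ih =>
      intro hi
      refine (ih (by omega)).trans (SimpleGraph.Adj.reachable ?_)
      simp [nutGraph_adj, NutAdj]
  have core_reach : ∀ g : G, (nutGraph σ idx).Reachable (path ⟨0, h0⟩) (core g) := fun g =>
    SimpleGraph.Adj.reachable (by simp [nutGraph_adj, NutAdj])
  refine (SimpleGraph.connected_iff_exists_forall_reachable _).2 ⟨path ⟨0, h0⟩, ?_⟩
  rintro (g | ⟨g, s, b⟩ | i)
  · exact core_reach g
  · refine (core_reach (if b then g * σ s else g)).trans (SimpleGraph.Adj.reachable ?_)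
    simp [nutGraph_adj, NutAdj]
  · exact path_reach i i.2

end

/-! ### Triangle conditions invariant under automorphisms -/

section

variable {V : Type*} (Γ : SimpleGraph V)

def InTriangle (v : V) : Prop := ∃ a b, Γ.Adj v a ∧ Γ.Adj v b ∧ Γ.Adj a b

/-- Designed to single out the mid vertices. -/
def TriangleInterior (v : V) : Prop := InTriangle Γ v ∧ ∀ u, Γ.Adj v u → InTriangle Γ u

/-- Designed to single out the core: an arc labelled by the identity closes a triangle on its core
vertex and two mid vertices. -/
def CapsInterior (v : V) : Prop :=
  ¬ TriangleInterior Γ v ∧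
    ∃ a b, TriangleInterior Γ a ∧ TriangleInterior Γ b ∧ Γ.Adj v a ∧ Γ.Adj v b ∧ Γ.Adj a b

variable {Γ}

theorem InTriangle.map {v : V} (h : InTriangle Γ v) (φ : Γ ≃g Γ) : InTriangle Γ (φ v) := by
  obtain ⟨a, b, h1, h2, h3⟩ := h
  exact ⟨φ a, φ b, φ.map_adj_iff.2 h1, φ.map_adj_iff.2 h2, φ.map_adj_iff.2 h3⟩

theorem inTriangle_apply_iff (φ : Γ ≃g Γ) (v : V) : InTriangle Γ (φ v) ↔ InTriangle Γ v :=
  ⟨fun h => by simpa using h.map φ.symm, fun h => h.map φ⟩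

theorem TriangleInterior.map {v : V} (h : TriangleInterior Γ v) (φ : Γ ≃g Γ) :
    TriangleInterior Γ (φ v) := by
  refine ⟨h.1.map φ, fun u hu => ?_⟩
  have := (h.2 (φ.symm u) (by rw [← φ.map_adj_iff]; simpa using hu)).map φ
  simpa using this

theorem triangleInterior_apply_iff (φ : Γ ≃g Γ) (v : V) :
    TriangleInterior Γ (φ v) ↔ TriangleInterior Γ v :=
  ⟨fun h => by simpa using h.map φ.symm, fun h => h.map φ⟩

theorem CapsInterior.map {v : V} (h : CapsInterior Γ v) (φ : Γ ≃g Γ) :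
    CapsInterior Γ (φ v) := by
  obtain ⟨h0, a, b, ha, hb, h1, h2, h3⟩ := h
  exact ⟨fun h => h0 ((triangleInterior_apply_iff φ v).1 h), φ a, φ b, ha.map φ, hb.map φ,
    φ.map_adj_iff.2 h1, φ.map_adj_iff.2 h2, φ.map_adj_iff.2 h3⟩

theorem capsInterior_apply_iff (φ : Γ ≃g Γ) (v : V) : CapsInterior Γ (φ v) ↔ CapsInterior Γ v :=
  ⟨fun h => by simpa using h.map φ.symm, fun h => h.map φ⟩

end

/-! ### Recognising vertex kinds; the automorphism group -/

section

variable {G S : Type*} [Group G] {m : ℕ} (σ : S → G) (idx : S × Bool ≃ Fin m)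

theorem inTriangle_core (g : G) (s : S) : InTriangle (nutGraph σ idx) (core g) := by
  have := (idx (s, false)).2
  refine ⟨mid g s false, path ⟨4 * (idx (s, false)).val, by omega⟩, ?_, ?_, ?_⟩ <;>
    simp [nutGraph_adj, NutAdj]

theorem inTriangle_mid (g : G) (s : S) (b : Bool) : InTriangle (nutGraph σ idx) (mid g s b) := by
  have := (idx (s, b)).2
  refine ⟨core (if b then g * σ s else g), path ⟨4 * (idx (s, b)).val, by omega⟩, ?_, ?_, ?_⟩ <;>
    simp [nutGraph_adj, NutAdj]

theorem inTriangle_path_iff (i : Fin (8 * m - 3)) :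
    InTriangle (nutGraph σ idx) (path i) ↔ 4 ∣ i.val ∧ i.val < 4 * m := by
  constructor
  · rintro ⟨a | ⟨g, s, b⟩ | j, c | ⟨h, t, d⟩ | l, h1, h2, h3⟩ <;>
      simp only [nutGraph_adj, NutAdj] at h1 h2 h3
    · have := (idx (t, d)).2; omega
    · omega
    · have := (idx (s, b)).2; omega
    · have := (idx (s, b)).2; omega
    · have := (idx (s, b)).2; omega
    · omega
    · have := (idx (t, d)).2; omega
    · omega
  · rintro ⟨⟨k, hk⟩, hi⟩
    obtain ⟨⟨s, b⟩, hs⟩ := idx.surjective ⟨k, by omega⟩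
    refine ⟨core (if b then 1 * σ s else 1), mid 1 s b, ?_, ?_, ?_⟩ <;>
      simp [nutGraph_adj, NutAdj, hs, hk]

theorem triangleInterior_mid (g : G) (s : S) (b : Bool) :
    TriangleInterior (nutGraph σ idx) (mid g s b) := by
  refine ⟨inTriangle_mid σ idx g s b, ?_⟩
  rintro (h | ⟨h, t, c⟩ | i) hu
  · exact inTriangle_core σ idx h s
  · exact inTriangle_mid σ idx h t c
  · rw [inTriangle_path_iff]
    have := (idx (s, b)).2
    simp only [nutGraph_adj, NutAdj] at hu
    omega

theorem not_triangleInterior_core (hm : 0 < m) (g : G) :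
    ¬ TriangleInterior (nutGraph σ idx) (core g) := by
  intro h
  -- Position `4 * m` is the first multiple of 4 with no mid vertex attached, hence in no triangle.
  have h1 := h.2 (path ⟨4 * m, by omega⟩) (by simp [nutGraph_adj, NutAdj])
  rw [inTriangle_path_iff] at h1
  simp at h1

theorem not_triangleInterior_path (i : Fin (8 * m - 3)) :
    ¬ TriangleInterior (nutGraph σ idx) (path i) := by
  rintro ⟨h, h'⟩
  rw [inTriangle_path_iff] at h
  have h1 := h' (path ⟨i.val + 1, by omega⟩) (by simp [nutGraph_adj, NutAdj])
  rw [inTriangle_path_iff] at h1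
  simp only at h1
  omega

theorem triangleInterior_iff (hm : 0 < m) (v : NutVertex G S (8 * m - 3)) :
    TriangleInterior (nutGraph σ idx) v ↔ ∃ g s b, v = mid g s b := by
  rcases v with g | ⟨g, s, b⟩ | i
  · simp [not_triangleInterior_core σ idx hm]
  · simp [triangleInterior_mid σ idx]
  · simp [not_triangleInterior_path σ idx]

theorem capsInterior_iff (hm : 0 < m) (hσ : ∃ s, σ s = 1) (v : NutVertex G S (8 * m - 3)) :
    CapsInterior (nutGraph σ idx) v ↔ ∃ g, v = core g := by
  constructor
  · rintro ⟨h0, a, b, ha, hb, h1, h2, h3⟩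
    rw [triangleInterior_iff σ idx hm] at ha hb h0
    obtain ⟨g, s, c, rfl⟩ := ha
    obtain ⟨h, t, d, rfl⟩ := hb
    rcases v with v | ⟨v, w, x⟩ | i
    · exact ⟨v, rfl⟩
    · exact absurd ⟨v, w, x, rfl⟩ h0
    · simp only [nutGraph_adj, NutAdj] at h1 h2 h3
      -- Adjacent mid vertices differ in their Boolean, so they are attached to different path
      -- positions.
      have h4 : idx (s, c) = idx (t, d) := Fin.ext (by omega)
      have h5 := idx.injective h4
      simp only [Prod.mk.injEq] at h5
      obtain ⟨_, _, h6⟩ := h3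
      rw [h5.2] at h6
      simp at h6
  · rintro ⟨g, rfl⟩
    obtain ⟨s, hs⟩ := hσ
    refine ⟨not_triangleInterior_core σ idx hm g, mid g s false, mid g s true,
      triangleInterior_mid σ idx _ _ _, triangleInterior_mid σ idx _ _ _, ?_, ?_, ?_⟩ <;>
      simp [nutGraph_adj, NutAdj, hs]

variable {σ idx}

theorem aut_core (hm : 0 < m) (hσ : ∃ s, σ s = 1) (φ : nutGraph σ idx ≃g nutGraph σ idx) (g : G) :
    ∃ h, φ (core g) = core h :=
  (capsInterior_iff σ idx hm hσ _).1 ((capsInterior_apply_iff φ _).2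
    ((capsInterior_iff σ idx hm hσ _).2 ⟨g, rfl⟩))

theorem aut_mid (hm : 0 < m) (φ : nutGraph σ idx ≃g nutGraph σ idx) (g : G) (s : S) (b : Bool) :
    ∃ h t c, φ (mid g s b) = mid h t c :=
  (triangleInterior_iff σ idx hm _).1 ((triangleInterior_mid σ idx g s b).map φ)

theorem aut_path (hm : 0 < m) (hσ : ∃ s, σ s = 1) (φ : nutGraph σ idx ≃g nutGraph σ idx)
    (i : Fin (8 * m - 3)) : ∃ j, φ (path i) = path j := by
  rcases h : φ (path i) with g | ⟨g, s, b⟩ | j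
  · obtain ⟨g', hg'⟩ := aut_core hm hσ φ.symm g
    rw [← h, RelIso.symm_apply_apply] at hg'
    cases hg'
  · obtain ⟨g', s', b', hg'⟩ := aut_mid hm φ.symm g s b
    rw [← h, RelIso.symm_apply_apply] at hg'
    cases hg'
  · exact ⟨j, rfl⟩

/-- The far end of the path lies in no triangle, so any other candidate image is interior to the
path and has two path neighbours, whereas position 0 has only one. -/
theorem aut_path_zero (hm : 0 < m) (hσ : ∃ s, σ s = 1) (φ : nutGraph σ idx ≃g nutGraph σ idx)
    (h0 : 0 < 8 * m - 3) : φ (path ⟨0, h0⟩) = path ⟨0, h0⟩ := by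
  obtain ⟨j, hj⟩ := aut_path hm hσ φ ⟨0, h0⟩
  have htri : InTriangle (nutGraph σ idx) (path j) :=
    hj ▸ InTriangle.map ((inTriangle_path_iff σ idx _).2 ⟨by simp, by simpa using hm⟩) φ
  rw [inTriangle_path_iff] at htri
  rcases Nat.eq_zero_or_pos j.val with hz | hpos
  · rw [hj]; congr 1; exact Fin.ext hz
  exfalso
  have nbr : ∀ l : Fin (8 * m - 3), (nutGraph σ idx).Adj (path j) (path l) →
      φ.symm (path l) = path ⟨1, by omega⟩ := by
    intro l hl
    obtain ⟨k, hk⟩ := aut_path hm hσ φ.symm l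
    have h1 := φ.symm.map_adj_iff.2 hl
    rw [← hj, RelIso.symm_apply_apply, hk] at h1
    simp only [nutGraph_adj, NutAdj] at h1
    rw [hk]; congr 1; apply Fin.ext; simp only; omega
  have h1 := nbr ⟨j.val - 1, by omega⟩ (by simp only [nutGraph_adj, NutAdj]; omega)
  have h2 := nbr ⟨j.val + 1, by omega⟩ (by simp [nutGraph_adj, NutAdj])
  have h3 := φ.symm.injective (h1.trans h2.symm)
  simp only [NutVertex.path.injEq, Fin.mk.injEq] at h3
  omega

theorem aut_path_eq (hm : 0 < m) (hσ : ∃ s, σ s = 1) (φ : nutGraph σ idx ≃g nutGraph σ idx) :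
    ∀ (i : ℕ) (hi : i < 8 * m - 3), φ (path ⟨i, hi⟩) = path ⟨i, hi⟩ := by
  intro i
  induction i using Nat.strong_induction_on with
  | _ i ih =>
  intro hi
  rcases i with _ | i
  · exact aut_path_zero hm hσ φ hi
  obtain ⟨j, hj⟩ := aut_path hm hσ φ ⟨i + 1, hi⟩
  have h1 : (nutGraph σ idx).Adj (path ⟨i, by omega⟩) (path ⟨i + 1, hi⟩) := by
    simp [nutGraph_adj, NutAdj]
  have h2 := φ.map_adj_iff.2 h1
  rw [ih i (by omega), hj] at h2
  simp only [nutGraph_adj, NutAdj] at h2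
  rcases h2 with h2 | h2
  · rw [hj]; congr 1; exact Fin.ext h2.symm
  -- Stepping back is impossible: that vertex is already its own image.
  · have h3 := ih j.val (by omega) (by omega)
    have h4 := φ.injective (h3.trans hj.symm)
    simp only [NutVertex.path.injEq, Fin.ext_iff] at h4
    omega

theorem aut_eq_translate (hm : 0 < m) (hσ : Function.Surjective σ)
    (φ : nutGraph σ idx ≃g nutGraph σ idx) : ∃ a, φ = nutTranslate σ idx a := by
  have hone := hσ 1
  choose π hπ using aut_core hm hone φ
  have hmid : ∀ g s b, φ (mid g s b) = mid (π g) s b := by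
    have kind : ∀ g s b, ∃ h, φ (mid g s b) = mid h s b := by
      intro g s b
      obtain ⟨h, t, c, e⟩ := aut_mid hm φ g s b
      have hlt := (idx (s, b)).2
      have h1 : (nutGraph σ idx).Adj (mid g s b) (path ⟨4 * (idx (s, b)).val, by omega⟩) := by
        simp [nutGraph_adj, NutAdj]
      have h2 := φ.map_adj_iff.2 h1
      rw [aut_path_eq hm hone, e] at h2
      simp only [nutGraph_adj, NutAdj] at h2
      have h3 := idx.injective (Fin.ext (by omega) : idx (s, b) = idx (t, c))
      simp only [Prod.mk.injEq] at h3
      exact ⟨h, by rw [e, h3.1, h3.2]⟩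
    have hfalse : ∀ g s, φ (mid g s false) = mid (π g) s false := by
      intro g s
      obtain ⟨h, e⟩ := kind g s false
      have h1 : (nutGraph σ idx).Adj (core g) (mid g s false) := by simp [nutGraph_adj, NutAdj]
      have h2 := φ.map_adj_iff.2 h1
      rw [hπ, e] at h2
      simp only [nutGraph_adj, NutAdj] at h2
      rw [e, h2]; simp
    rintro g s (_ | _)
    · exact hfalse g s
    · obtain ⟨h, e⟩ := kind g s true
      have h1 : (nutGraph σ idx).Adj (mid g s false) (mid g s true) := by
        simp [nutGraph_adj, NutAdj]
      have h2 := φ.map_adj_iff.2 h1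
      rw [hfalse, e] at h2
      simp only [nutGraph_adj, NutAdj] at h2
      rw [e, h2.1]
  have hmul : ∀ g h, π (g * h) = π g * h := by
    intro g h
    obtain ⟨s, rfl⟩ := hσ h
    have h1 : (nutGraph σ idx).Adj (core (g * σ s)) (mid g s true) := by
      simp [nutGraph_adj, NutAdj]
    have h2 := φ.map_adj_iff.2 h1
    rw [hπ, hmid] at h2
    simpa [nutGraph_adj, NutAdj] using h2
  have hleft : ∀ g, π g = π 1 * g := fun g => by simpa using hmul 1 g
  refine ⟨π 1, ?_⟩
  ext v
  rcases v with g | ⟨g, s, b⟩ | i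
  · rw [hπ, hleft]; rfl
  · rw [hmid, hleft]; rfl
  · rw [aut_path_eq hm hone]; rfl

theorem nutTranslateHom_bijective (hm : 0 < m) (hσ : Function.Surjective σ) :
    Function.Bijective (nutTranslateHom σ idx) := by
  constructor
  · intro a b h
    have h1 : nutTranslate σ idx a (core 1) = nutTranslate σ idx b (core 1) :=
      congrArg (fun φ : nutGraph σ idx ≃g nutGraph σ idx => φ (core 1)) h
    simpa [nutTranslate] using h1
  · intro φ
    obtain ⟨a, rfl⟩ := aut_eq_translate hm hσ φ
    exact ⟨a, rfl⟩

noncomputable def nutGraphAut (hm : 0 < m) (hσ : Function.Surjective σ) :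
    (nutGraph σ idx ≃g nutGraph σ idx) ≃* G :=
  (MulEquiv.ofBijective (nutTranslateHom σ idx) (nutTranslateHom_bijective hm hσ)).symm

end

/-! ### The kernel is at most one-dimensional -/

theorem sum_fin_ite_val_eq {K : ℕ} (f : Fin K → ℝ) (c : ℕ) :
    ∑ j : Fin K, (if c = j.val then f j else 0) = if h : c < K then f ⟨c, h⟩ else 0 := by
  split_ifs with h
  · rw [Finset.sum_eq_single ⟨c, h⟩]
    · simp
    · intro j _ hj
      rw [if_neg]
      rintro rfl
      exact hj rfl
    · simp
  · refine Finset.sum_eq_zero fun j _ => if_neg ?_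
    rintro rfl
    exact h j.2

theorem card_multiples_of_four (m : ℕ) :
    (Finset.univ.filter fun i : Fin (8 * m - 3) => 4 ∣ i.val).card = 2 * m := by
  have : (Finset.univ.filter fun i : Fin (8 * m - 3) => 4 ∣ i.val) =
      Finset.univ.image
        (fun k : Fin (2 * m) => (⟨4 * k.val, by omega⟩ : Fin (8 * m - 3))) := by
    ext i
    simp only [Finset.mem_filter, Finset.mem_univ, true_and, Finset.mem_image, Fin.ext_iff]
    constructor
    · rintro ⟨k, hk⟩
      exact ⟨⟨k, by omega⟩, hk.symm⟩
    · rintro ⟨k, hk⟩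
      exact ⟨k, hk.symm⟩
  rw [this, Finset.card_image_of_injective _ (fun a b h => by
    simp only [Fin.ext_iff] at h ⊢; omega), Finset.card_univ, Fintype.card_fin]

section

variable {G S : Type*} {K : ℕ}

/-- The values along the path, extended by zero past its end. -/
def pathVal (x : NutVertex G S K → ℝ) (i : ℕ) : ℝ :=
  if h : i < K then x (path ⟨i, h⟩) else 0

theorem pathVal_of_lt (x : NutVertex G S K → ℝ) {i : ℕ} (h : i < K) :
    pathVal x i = x (path ⟨i, h⟩) := dif_pos h

theorem sum_path_neighbours (x : NutVertex G S K → ℝ) (i : ℕ) :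
    ∑ j : Fin K, (if i + 1 = j.val ∨ j.val + 1 = i then x (path j) else 0) =
      pathVal x (i + 1) + if i = 0 then 0 else pathVal x (i - 1) := by
  have h1 : ∀ j : Fin K, (if i + 1 = j.val ∨ j.val + 1 = i then x (path j) else 0) =
      (if i + 1 = j.val then x (path j) else 0) +
        if i = 0 then 0 else if i - 1 = j.val then x (path j) else 0 := by
    intro j
    by_cases ha : i + 1 = j.val
    · rw [if_pos (Or.inl ha), if_pos ha]
      split_ifs
      · simp
      · omega
      · simp
    · by_cases hb : j.val + 1 = i
      · rw [if_pos (Or.inr hb), if_neg ha, if_neg (by omega), if_pos (by omega), zero_add]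
      · rw [if_neg (by tauto), if_neg ha]
        split_ifs
        · simp
        · omega
        · simp
  rw [Finset.sum_congr rfl fun j _ => h1 j, Finset.sum_add_distrib,
    sum_fin_ite_val_eq (fun j => x (path j))]
  congr 1
  split_ifs with h
  · simp
  · exact sum_fin_ite_val_eq (fun j => x (path j)) _

end

section

open Classical in
/-- The equations that define the kernel of the adjacency matrix, vertex kind by vertex kind. -/
theorem mem_adjKer_nutGraph {G S : Type*} [Group G] [Fintype G] [Fintype S] {m : ℕ} (σ : S → G)
    (idx : S × Bool ≃ Fin m) (x : NutVertex G S (8 * m - 3) → ℝ) :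
    x ∈ adjKer (nutGraph σ idx) ↔
      (∀ g, ∑ s, (x (mid g s false) + x (mid (g * (σ s)⁻¹) s true)) +
        ∑ i : Fin (8 * m - 3), (if 4 ∣ i.val then x (path i) else 0) = 0) ∧
      (∀ g s b, x (core (if b then g * σ s else g)) + x (mid g s !b) +
        pathVal x (4 * (idx (s, b)).val) = 0) ∧
      ∀ i : Fin (8 * m - 3), (if 4 ∣ i.val then ∑ g, x (core g) else 0) +
        ∑ g, ∑ s, ((if i.val = 4 * (idx (s, false)).val then x (mid g s false) else 0) +
          (if i.val = 4 * (idx (s, true)).val then x (mid g s true) else 0)) +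
        (pathVal x (i + 1) + if i.val = 0 then 0 else pathVal x (i - 1)) = 0 := by
  rw [mem_adjKer_iff]
  have hcore : ∀ g, ∑ w, (if (nutGraph σ idx).Adj (core g) w then x w else 0) =
      ∑ s, (x (mid g s false) + x (mid (g * (σ s)⁻¹) s true)) +
        ∑ i : Fin (8 * m - 3), (if 4 ∣ i.val then x (path i) else 0) := by
    intro g
    rw [NutVertex.sum_eq]
    simp only [nutGraph_adj, NutAdj, if_false, Finset.sum_const_zero, zero_add, Bool.false_eq_true,
      if_true, ← mul_inv_eq_iff_eq_mul]
    congr 1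
    rw [Finset.sum_comm]
    simp [Finset.sum_add_distrib]
  have hmid : ∀ g s b, ∑ w, (if (nutGraph σ idx).Adj (mid g s b) w then x w else 0) =
      x (core (if b then g * σ s else g)) + x (mid g s !b) +
        pathVal x (4 * (idx (s, b)).val) := by
    intro g s b
    rw [NutVertex.sum_eq]
    simp only [nutGraph_adj, NutAdj]
    congr 1
    · congr 1
      · simp
      · rw [Finset.sum_eq_single g, Finset.sum_eq_single s]
        · cases b <;> simp
        · intro t _ ht; simp [ht.symm]
        · simp
        · intro h _ hh; simp [hh.symm]
        · simp
    · rw [pathVal, ← sum_fin_ite_val_eq (fun j => x (path j))]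
      simp only [eq_comm]
  have hpath : ∀ i : Fin (8 * m - 3),
      ∑ w, (if (nutGraph σ idx).Adj (path i) w then x w else 0) =
      (if 4 ∣ i.val then ∑ g, x (core g) else 0) +
        ∑ g, ∑ s, ((if i.val = 4 * (idx (s, false)).val then x (mid g s false) else 0) +
          (if i.val = 4 * (idx (s, true)).val then x (mid g s true) else 0)) +
        (pathVal x (i + 1) + if i.val = 0 then 0 else pathVal x (i - 1)) := by
    intro i
    rw [NutVertex.sum_eq, ← sum_path_neighbours]
    simp only [nutGraph_adj, NutAdj]
    congr 2
    split_ifs <;> simp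
  constructor
  · intro h
    exact ⟨fun g => hcore g ▸ h _, fun g s b => hmid g s b ▸ h _, fun i => hpath i ▸ h _⟩
  · rintro ⟨h1, h2, h3⟩ (g | ⟨g, s, b⟩ | i)
    · rw [hcore, h1]
    · rw [hmid, h2]
    · rw [hpath, h3]

variable {G S : Type*} [Group G] [Fintype G] [Fintype S] {m : ℕ} {σ : S → G}
  {idx : S × Bool ≃ Fin m}

theorem pathVal_even_eq_zero {x : NutVertex G S (8 * m - 3) → ℝ}
    (hx : x ∈ adjKer (nutGraph σ idx)) (h0 : pathVal x 0 = 0) (j : ℕ) :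
    pathVal x (2 * j) = 0 := by
  classical
  rw [mem_adjKer_nutGraph] at hx
  induction j with
  | zero => exact h0
  | succ j ih =>
    by_cases hj : 2 * (j + 1) < 8 * m - 3
    · have h := hx.2.2 ⟨2 * j + 1, by omega⟩
      simp only at h
      rw [if_neg (by omega), if_neg (by omega), Finset.sum_eq_zero, Nat.add_sub_cancel, ih] at h
      · simpa [mul_add] using h
      · intro g _
        refine Finset.sum_eq_zero fun s _ => ?_
        rw [if_neg (by omega), if_neg (by omega), add_zero]
    · exact dif_neg hj

/-- With the even path entries zero, each mid entry is minus the core entry next to its partner. The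
core equations then involve only the core, and both orientations of the arcs contribute the same
total plus `l` times the entry itself. -/
theorem eq_zero_of_mem_adjKer {x : NutVertex G S (8 * m - 3) → ℝ} {l : ℝ} (hl : 0 < l)
    (hσ : ∀ f : G → ℝ, ∑ s, f (σ s) = ∑ g, f g + l * f 1)
    (hx : x ∈ adjKer (nutGraph σ idx)) (h0 : pathVal x 0 = 0) : x = 0 := by
  classical
  have heven := pathVal_even_eq_zero hx h0
  rw [mem_adjKer_nutGraph] at hx
  obtain ⟨h1, h2, h3⟩ := hx
  have hquad : ∀ k, pathVal x (4 * k) = 0 := fun k => by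
    rw [show 4 * k = 2 * (2 * k) by ring]; exact heven _
  have hmf : ∀ g s, x (mid g s false) = - x (core (g * σ s)) := by
    intro g s
    have := h2 g s true
    rw [hquad] at this
    simp only [if_true, Bool.not_true] at this
    linarith
  have hmt : ∀ g s, x (mid g s true) = - x (core g) := by
    intro g s
    have := h2 g s false
    rw [hquad] at this
    simp only [Bool.false_eq_true, if_false, Bool.not_false] at this
    linarith
  have hcore_mul : ∀ g, l * x (core g) = - ∑ h, x (core h) := by
    intro g
    have h := h1 g
    rw [Finset.sum_eq_zero (s := Finset.univ) (f := fun i : Fin (8 * m - 3) =>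
      if 4 ∣ i.val then x (path i) else 0), add_zero, Finset.sum_add_distrib] at h
    · simp only [hmf, hmt, Finset.sum_neg_distrib] at h
      rw [hσ (fun a => x (core (g * a))), hσ (fun a => x (core (g * a⁻¹)))] at h
      have e1 : ∑ a, x (core (g * a)) = ∑ h, x (core h) :=
        Equiv.sum_comp (Equiv.mulLeft g) (fun h => x (core h))
      have e2 : ∑ a, x (core (g * a⁻¹)) = ∑ h, x (core h) :=
        Equiv.sum_comp ((Equiv.inv G).trans (Equiv.mulLeft g)) (fun h => x (core h))
      rw [e1, e2] at h
      simp only [mul_one, inv_one] at h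
      linarith
    · intro i _
      split_ifs with hi
      · obtain ⟨k, hk⟩ := hi
        rw [← hquad k, pathVal_of_lt x (hk ▸ i.2)]
        congr 2
        exact Fin.ext hk
      · rfl
  have hsum : ∑ h, x (core h) = 0 := by
    have h : l * ∑ g, x (core g) = ∑ g : G, (- ∑ h, x (core h)) := by
      rw [Finset.mul_sum]
      exact Finset.sum_congr rfl fun g _ => hcore_mul g
    rw [Finset.sum_const, nsmul_eq_mul, Finset.card_univ] at h
    have h' : (l + Fintype.card G) * ∑ g, x (core g) = 0 := by linarith
    exact (mul_eq_zero.1 h').resolve_left (by positivity)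
  have hcore : ∀ g, x (core g) = 0 := by
    intro g
    have := hcore_mul g
    rw [hsum, neg_zero] at this
    exact (mul_eq_zero.1 this).resolve_left hl.ne'
  have hmid : ∀ g s b, x (mid g s b) = 0 := by
    rintro g s (_ | _)
    · rw [hmf, hcore, neg_zero]
    · rw [hmt, hcore, neg_zero]
  have hodd : ∀ j, pathVal x (2 * j + 1) = 0 := by
    intro j
    by_cases hj : 2 * j < 8 * m - 3
    · induction j with
      | zero =>
        -- Position 0 has no predecessor, which starts the recursion for odd positions.
        have h := h3 ⟨0, by omega⟩
        simpa [hcore, hmid] using h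
      | succ j ih =>
        have h := h3 ⟨2 * (j + 1), hj⟩
        have ih' := ih (by omega)
        simp only [hcore, hmid] at h
        rw [show 2 * (j + 1) - 1 = 2 * j + 1 by omega, ih'] at h
        simpa using h
    · exact dif_neg (by omega)
  funext v
  rcases v with g | ⟨g, s, b⟩ | i
  · exact hcore g
  · exact hmid g s b
  · have h : x (path i) = pathVal x i.val := (pathVal_of_lt x i.2).symm
    rw [h]
    rcases Nat.even_or_odd' i.val with ⟨j, hj | hj⟩
    · rw [hj, heven]; rfl
    · rw [hj, hodd]; rfl

/-! ### An explicit nowhere zero kernel vector -/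

/-- The values of the kernel vector along the path, for `n` core vertices. -/
def nutPathValue (n m i : ℕ) : ℝ :=
  if i % 4 = 0 then 1 else if i % 4 = 2 then -1
  else if i % 4 = 1 then n * (min (i / 4 + 1) (2 * m - 1 - i / 4) : ℕ)
  else -(n * (min (i / 4 + 1) (2 * m - 1 - i / 4) : ℕ))

theorem nutPathValue_ne_zero {n m i : ℕ} (hn : 0 < n) (hi : i < 8 * m - 3) :
    nutPathValue n m i ≠ 0 := by
  have hn' : (n : ℝ) ≠ 0 := by positivity
  have h : i % 4 = 1 ∨ i % 4 = 3 → ((min (i / 4 + 1) (2 * m - 1 - i / 4) : ℕ) : ℝ) ≠ 0 := by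
    intro h
    rw [Nat.cast_ne_zero]
    omega
  unfold nutPathValue
  split_ifs with h0 h2 h1
  · norm_num
  · norm_num
  · exact mul_ne_zero hn' (h (Or.inl h1))
  · exact neg_ne_zero.2 (mul_ne_zero hn' (h (Or.inr (by omega))))

def nutVector (n m : ℕ) : NutVertex G S (8 * m - 3) → ℝ
  | core _ => 1
  | mid _ _ _ => -2
  | path i => nutPathValue n m i

/-- The position just past the end is included: the tent function reaches zero there, matching the
default value, so the last vertex needs no separate case. -/
theorem pathVal_nutVector {H T : Type*} {n i : ℕ} (hi : i ≤ 8 * m - 3) (hm : 0 < m) :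
    pathVal (nutVector n m : NutVertex H T (8 * m - 3) → ℝ) i = nutPathValue n m i := by
  unfold pathVal
  split_ifs with h
  · rfl
  · have e : i = 8 * m - 3 := by omega
    unfold nutPathValue
    rw [if_neg (by omega), if_neg (by omega), if_pos (by omega)]
    have : min (i / 4 + 1) (2 * m - 1 - i / 4) = 0 := by omega
    simp [this]

/-- At multiples of 4, core and mid vertices contribute `n - 2n` in the first half and `n` in the
second; the tent has slope `n`, then `-n`, to cancel this. Elsewhere the two path neighbours are
opposite. -/
theorem nutPathValue_recurrence {n i : ℕ} (hi : i < 8 * m - 3) :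
    (if 4 ∣ i then (n : ℝ) else 0) + (n * if 4 ∣ i ∧ i < 4 * m then (-2 : ℝ) else 0) +
      (nutPathValue n m (i + 1) + if i = 0 then 0 else nutPathValue n m (i - 1)) = 0 := by
  have hcases : i % 4 = 0 ∨ i % 4 = 1 ∨ i % 4 = 2 ∨ i % 4 = 3 := by omega
  rcases hcases with h | h | h | h
  · obtain ⟨k, rfl⟩ : 4 ∣ i := by omega
    have e1 : nutPathValue n m (4 * k + 1) = n * (min (k + 1) (2 * m - 1 - k) : ℕ) := by
      unfold nutPathValue
      rw [if_neg (by omega), if_neg (by omega), if_pos (by omega),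
        show (4 * k + 1) / 4 = k by omega]
    have e2 : (if 4 * k = 0 then 0 else nutPathValue n m (4 * k - 1)) =
        -(n * (min k (2 * m - k) : ℕ)) := by
      split_ifs with h0
      · rw [show k = 0 by omega]; simp
      · unfold nutPathValue
        rw [if_neg (by omega), if_neg (by omega), if_neg (by omega),
          show (4 * k - 1) / 4 + 1 = k by omega,
          show 2 * m - 1 - (4 * k - 1) / 4 = 2 * m - k by omega]
    rw [e1, e2, if_pos (by simp)]
    by_cases hk : k < m
    · rw [if_pos ⟨by simp, by omega⟩, show min (k + 1) (2 * m - 1 - k) = k + 1 by omega,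
        show min k (2 * m - k) = k by omega]
      push_cast; ring
    · rw [if_neg (by omega),
        show min k (2 * m - k) = min (k + 1) (2 * m - 1 - k) + 1 by omega]
      push_cast; ring
  · rw [if_neg (by omega), if_neg (by omega), if_neg (by omega)]
    unfold nutPathValue
    rw [if_neg (by omega), if_pos (by omega), if_pos (by omega)]
    ring
  · rw [if_neg (by omega), if_neg (by omega), if_neg (by omega)]
    unfold nutPathValue
    rw [if_neg (by omega), if_neg (by omega), if_neg (by omega),
      if_neg (by omega), if_neg (by omega), if_pos (by omega),
      show (i + 1) / 4 = i / 4 by omega, show (i - 1) / 4 = i / 4 by omega]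
    ring
  · rw [if_neg (by omega), if_neg (by omega), if_neg (by omega)]
    unfold nutPathValue
    rw [if_pos (by omega), if_neg (by omega), if_pos (by omega)]
    ring

theorem sum_ite_idx (idx : S × Bool ≃ Fin m) (i : ℕ) (c : ℝ) :
    ∑ s, ((if i = 4 * (idx (s, false)).val then c else 0) +
      (if i = 4 * (idx (s, true)).val then c else 0)) =
      if 4 ∣ i ∧ i < 4 * m then c else 0 := by
  have e : ∑ s, ((if i = 4 * (idx (s, false)).val then c else 0) +
      (if i = 4 * (idx (s, true)).val then c else 0)) =
      ∑ k : Fin m, if i = 4 * k.val then c else 0 := by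
    rw [← idx.sum_comp, Fintype.sum_prod_type]
    simp [add_comm]
  rw [e]
  split_ifs with h
  · obtain ⟨⟨k, rfl⟩, hk⟩ := h
    rw [Finset.sum_eq_single ⟨k, by omega⟩]
    · simp
    · intro j _ hj
      rw [if_neg]
      intro h
      exact hj (Fin.ext (by simp only; omega))
    · simp
  · refine Finset.sum_eq_zero fun k _ => if_neg ?_
    have := k.2
    omega

theorem nutVector_mem_adjKer (hm : 0 < m) :
    nutVector (Fintype.card G) m ∈ adjKer (nutGraph σ idx) := by
  classical
  -- At a core vertex the mid neighbours sum to `-4 |S| = -2m`, balanced by the `2m` path neighbours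
  -- of value 1; this dictates the length of the path.
  have hmS : (m : ℝ) = 2 * Fintype.card S := by
    have := Fintype.card_congr idx
    simp only [Fintype.card_prod, Fintype.card_bool, Fintype.card_fin] at this
    rw [← this]; push_cast; ring
  rw [mem_adjKer_nutGraph]
  refine ⟨?_, ?_, ?_⟩
  · intro g
    have h : ∀ i : Fin (8 * m - 3), (if 4 ∣ i.val then
        (nutVector (Fintype.card G) m : NutVertex G S _ → ℝ) (path i) else 0) =
        if 4 ∣ i.val then (1 : ℝ) else 0 := by
      intro i
      split_ifs with hi
      · exact if_pos (by omega)
      · rfl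
    rw [Finset.sum_congr rfl fun i _ => h i, Finset.sum_boole, card_multiples_of_four]
    simp only [nutVector, Finset.sum_const, Finset.card_univ, nsmul_eq_mul]
    push_cast
    rw [hmS]; ring
  · intro g s b
    have := (idx (s, b)).2
    have e : nutPathValue (Fintype.card G) m (4 * (idx (s, b)).val) = 1 := if_pos (by omega)
    rw [pathVal_nutVector (by omega) hm, e]
    simp only [nutVector]
    norm_num
  · intro i
    rw [pathVal_nutVector (by omega) hm, pathVal_nutVector (by omega) hm]
    refine Eq.trans ?_ (nutPathValue_recurrence (n := Fintype.card G) i.2)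
    simp only [nutVector, sum_ite_idx]
    simp

theorem nutGraph_isNutGraph (hm : 0 < m) {l : ℝ} (hl : 0 < l)
    (hσ : ∀ f : G → ℝ, ∑ s, f (σ s) = ∑ g, f g + l * f 1) :
    IsNutGraph (nutGraph σ idx) := by
  have h0 : 0 < 8 * m - 3 := by omega
  refine isNutGraph_of_kernel_vector _ ?_ _ ?_ (nutVector_mem_adjKer hm) (path ⟨0, h0⟩) ?_
  · rw [NutVertex.card_eq]; omega
  · rintro (g | ⟨g, s, b⟩ | i)
    · exact one_ne_zero
    · simp [nutVector]
    · exact nutPathValue_ne_zero Fintype.card_pos i.2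
  · intro x hx hx0
    exact eq_zero_of_mem_adjKer hl hσ hx (by rw [pathVal_of_lt x h0, hx0])

end

/-! ### The infinite family -/

/-- Every element of `G` once, and the identity `k + 1` further times. -/
def paddedElements (G : Type*) [One G] (k : ℕ) : G ⊕ Fin (k + 1) → G :=
  Sum.elim id fun _ => 1

theorem theorem1 (𝔊 : Type*) [Group 𝔊] [Finite 𝔊] :
    ∃ (n : ℕ → ℕ) (Γ : (k : ℕ) → SimpleGraph (Fin (n k))),
      (∀ i j, i ≠ j → IsEmpty (Γ i ≃g Γ j)) ∧
      ∀ k, (Γ k).Connected ∧ IsNutGraph (Γ k) ∧ Nonempty ((Γ k ≃g Γ k) ≃* 𝔊) := by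
  have := Fintype.ofFinite 𝔊
  let m : ℕ → ℕ := fun k => Fintype.card ((𝔊 ⊕ Fin (k + 1)) × Bool)
  have hmk : ∀ k, m k = (Fintype.card 𝔊 + (k + 1)) * 2 := fun k => by simp [m]
  have hm : ∀ k, 0 < m k := fun k => by rw [hmk]; omega
  let Δ : ∀ k, SimpleGraph (NutVertex 𝔊 (𝔊 ⊕ Fin (k + 1)) (8 * m k - 3)) := fun k =>
    nutGraph (paddedElements 𝔊 k) (Fintype.equivFin _)
  have hsurj : ∀ k, Function.Surjective (paddedElements 𝔊 k) := fun k g => ⟨.inl g, rfl⟩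
  refine ⟨fun k => Fintype.card (NutVertex 𝔊 (𝔊 ⊕ Fin (k + 1)) (8 * m k - 3)),
    fun k => (Δ k).overFin rfl, ?_, ?_⟩
  · refine fun i j hij => ⟨fun e => hij ?_⟩
    have h := Fintype.card_congr e.toEquiv
    simp only [Fintype.card_fin, NutVertex.card_eq, Fintype.card_sum, hmk] at h
    by_contra hne
    -- The order of the graph strictly increases with the number of extra identities.
    have mono : ∀ a b : ℕ, a < b →
        Fintype.card 𝔊 + Fintype.card 𝔊 * ((Fintype.card 𝔊 + (a + 1)) * 2) +
          (8 * ((Fintype.card 𝔊 + (a + 1)) * 2) - 3) <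
        Fintype.card 𝔊 + Fintype.card 𝔊 * ((Fintype.card 𝔊 + (b + 1)) * 2) +
          (8 * ((Fintype.card 𝔊 + (b + 1)) * 2) - 3) := by
      intro a b hab
      have := Nat.mul_le_mul_left (Fintype.card 𝔊)
        (show (Fintype.card 𝔊 + (a + 1)) * 2 ≤ (Fintype.card 𝔊 + (b + 1)) * 2 by omega)
      omega
    rcases Nat.lt_or_gt_of_ne hne with hlt | hlt
    · exact absurd h (mono i j hlt).ne
    · exact absurd h (mono j i hlt).ne'
  · intro k
    let e := (Δ k).overFinIso rfl
    refine ⟨e.connected_iff.1 (nutGraph_connected _ _ (hm k)), IsNutGraph.of_iso e ?_,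
      ⟨(autCongr e).trans (nutGraphAut (hm k) (hsurj k))⟩⟩
    refine nutGraph_isNutGraph (hm k) (l := k + 1) (by positivity) fun f => ?_
    simp [paddedElements]
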